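/- For real $v$ and $x>0$ let $$I_v(x)=\sum_{n=0}^{\infty}\frac{(x/2)^{2n+v}}{n!\,\Gamma(v+n+1)}$$ be the modified Bessel function of the first kind (with $1/\Gamma=0$ at the poles of $\Gamma$), and let $$K_v(x)=\frac{\pi}{2}\,\frac{I_{-v}(x)-I_v(x)}{\sin(v\pi)}$$ be the modified Bessel function of the second kind, where for integer $v$ the right-hand side is replaced by its limit as the order tends to $v$. Let $v\in\mathbb{R}$ with $|v|\neq 1/2$. Then for every $x>0$, with $K_v'$ denoting the derivative in $x$, $$-\sqrt{x^2+x+\max\left(|v|,\tfrac12\right)^2}<\frac{x\,K_v'(x)}{K_v(x)}<-\sqrt{x^2+x+\min\left(|v|,\tfrac12\right)^2}.$$ -/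

import Mathlib

open Filter Topology

noncomputable section

/-- The modified Bessel function of the first kind `I_v(x)`, by its power series, for real order `v`
and `x > 0`. Since `Real.Gamma` is `0` at the poles `0, -1, -2, …` of the Gamma function and
`a / 0 = 0`, the terms with `v + n + 1` at a pole vanish, which is the usual convention
`1 / Γ = 0` there. -/
def besselI (v x : ℝ) : ℝ :=
  ∑' n : ℕ, (x / 2) ^ (2 * (n : ℝ) + v) / ((n.factorial : ℝ) * Real.Gamma (v + n + 1))

/-- The quotient `(π / 2) (I_{-v}(x) - I_v(x)) / sin (v π)`, meaningful for `v` not an integer. -/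
def besselKQuotient (v x : ℝ) : ℝ :=
  Real.pi / 2 * ((besselI (-v) x - besselI v x) / Real.sin (v * Real.pi))

open Classical in
/-- The modified Bessel function of the second kind `K_v(x)`: the quotient above when `v` is not an
integer, and the limit of that quotient as the order `w ≠ v` tends to `v` when `v` is an integer. -/
def besselK (v x : ℝ) : ℝ :=
  if v ∈ Set.range (Int.cast : ℤ → ℝ) then
    limUnder (𝓝[≠] v) (fun w : ℝ => besselKQuotient w x)
  else besselKQuotient v x

end

/-! Put θ = x K_v', L = θ + (x + 1/2) K_v and Q = θ² - (x² + x + v²) K_v². Bessel's equation x θ' =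
(x² + v²) K_v gives (e^{-x} x^{-1/2} L)' = (v² - 1/4) e^{-x} x^{-3/2} K_v and Q' = -2 K_v L. Since
K_v > 0 and everything tends to 0 at infinity, monotonicity gives first L and then Q the sign of 1/4
- v². As x² + x + 1/4 = (x + 1/2)², the sign of L is the bound with 1/2, and that of Q, with θ < 0,
is the bound with |v|.

Positivity and decay of K_v come from its integral representation (`besselK_eq`). For 0 < v < 1 the
difference between integral and series solves, together with its counterpart at 1 - v, a linear
system with zero initial values, so it vanishes. The shift v ↦ v + 1 and reflection v ↦ -v reach all
non-integer orders, and continuity in v the integers. -/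

open Filter Topology MeasureTheory Set

/-! ### The integral representation. -/

/-- The integral `∫₀^∞ t ^ (-v - 1) exp (-t - z / t) dt`, which equals
`2 (x / 2) ^ (-v) K_v(x)` for `z = x ^ 2 / 4`. -/
noncomputable def besselIntegral (v z : ℝ) : ℝ :=
  ∫ t in Ioi (0 : ℝ), t ^ (-v - 1) * Real.exp (-t - z / t)

theorem besselIntegrand_continuousOn (v z : ℝ) :
    ContinuousOn (fun t : ℝ => t ^ (-v - 1) * Real.exp (-t - z / t)) (Ioi 0) := by
  intro t ht
  have ht' : t ≠ 0 := (ne_of_gt ht)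
  refine ContinuousAt.continuousWithinAt ?_
  refine (Real.continuousAt_rpow_const _ _ (Or.inl ht')).mul ?_
  have : ContinuousAt (fun t : ℝ => -t - z / t) t := by fun_prop (disch := assumption)
  exact Real.continuous_exp.continuousAt.comp this

theorem besselIntegrand_aestronglyMeasurable (v z : ℝ) :
    AEStronglyMeasurable (fun t : ℝ => t ^ (-v - 1) * Real.exp (-t - z / t))
      (volume.restrict (Ioi 0)) :=
  (besselIntegrand_continuousOn v z).aestronglyMeasurable measurableSet_Ioi

theorem besselIntegrand_pos (v z : ℝ) {t : ℝ} (ht : 0 < t) :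
    0 < t ^ (-v - 1) * Real.exp (-t - z / t) := by positivity

/-- Keeping one Taylor term of exp (z / t) leaves a Gamma integrand. With m > v it serves both
integrability at 0 and decay in z. -/
theorem besselIntegrand_le (v : ℝ) (m : ℕ) {z t : ℝ} (hz : 0 < z) (ht : 0 < t) :
    t ^ (-v - 1) * Real.exp (-t - z / t) ≤
      m.factorial / z ^ m * (Real.exp (-t) * t ^ ((m - v) - 1)) := by
  have h1 : Real.exp (-(z / t)) ≤ m.factorial * (t / z) ^ m := by
    have h := Real.pow_div_factorial_le_exp (z / t) (by positivity) m
    rw [Real.exp_neg, inv_le_comm₀ (Real.exp_pos _) (by positivity)]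
    refine le_trans (le_of_eq ?_) h
    rw [mul_inv, ← inv_pow, inv_div]; ring
  have h2 : t ^ ((m - v) - 1) = t ^ (-v - 1) * t ^ m := by
    rw [← Real.rpow_natCast t m, ← Real.rpow_add ht]; congr 1; ring
  rw [sub_eq_add_neg (-t), Real.exp_add, h2]
  calc t ^ (-v - 1) * (Real.exp (-t) * Real.exp (-(z / t)))
      ≤ t ^ (-v - 1) * (Real.exp (-t) * (m.factorial * (t / z) ^ m)) := by gcongr
    _ = _ := by rw [div_pow]; ring

theorem besselIntegrand_integrableOn (v : ℝ) {z : ℝ} (hz : 0 < z) :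
    IntegrableOn (fun t : ℝ => t ^ (-v - 1) * Real.exp (-t - z / t)) (Ioi 0) := by
  obtain ⟨m, hm⟩ := exists_nat_gt v
  refine Integrable.mono' ((Real.GammaIntegral_convergent (sub_pos.2 hm)).const_mul
    (m.factorial / z ^ m)) (besselIntegrand_aestronglyMeasurable v z) ?_
  refine (ae_restrict_mem measurableSet_Ioi).mono fun t ht => ?_
  rw [Real.norm_of_nonneg (besselIntegrand_pos v z ht).le]
  exact besselIntegrand_le v m hz ht

theorem besselIntegral_pos (v : ℝ) {z : ℝ} (hz : 0 < z) : 0 < besselIntegral v z := by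
  unfold besselIntegral
  rw [setIntegral_pos_iff_support_of_nonneg_ae]
  · have : (Function.support fun t : ℝ => t ^ (-v - 1) * Real.exp (-t - z / t)) ∩ Ioi 0
        = Ioi 0 :=
      inter_eq_right.2 fun t ht => (besselIntegrand_pos v z ht).ne'
    rw [this]; simp
  · exact (ae_restrict_mem measurableSet_Ioi).mono fun t ht => (besselIntegrand_pos v z ht).le
  · exact besselIntegrand_integrableOn v hz

theorem besselIntegral_le (v : ℝ) (m : ℕ) (hm : v < m) {z : ℝ} (hz : 0 < z) :
    besselIntegral v z ≤ m.factorial / z ^ m * Real.Gamma (m - v) := by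
  rw [Real.Gamma_eq_integral (sub_pos.2 hm), ← integral_const_mul]
  exact setIntegral_mono_on (besselIntegrand_integrableOn v hz)
    ((Real.GammaIntegral_convergent (sub_pos.2 hm)).const_mul _) measurableSet_Ioi
    fun t ht => besselIntegrand_le v m hz ht

theorem hasDerivAt_besselIntegral (v : ℝ) {z : ℝ} (hz : 0 < z) :
    HasDerivAt (besselIntegral v) (-besselIntegral (v + 1) z) z := by
  have key := hasDerivAt_integral_of_dominated_loc_of_deriv_le
    (μ := volume.restrict (Ioi (0 : ℝ)))
    (F := fun z t : ℝ => t ^ (-v - 1) * Real.exp (-t - z / t))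
    (F' := fun z t : ℝ => -(t ^ (-(v + 1) - 1) * Real.exp (-t - z / t)))
    (bound := fun t : ℝ => t ^ (-(v + 1) - 1) * Real.exp (-t - (z / 2) / t))
    (x₀ := z) (s := Ioi (z / 2)) (Ioi_mem_nhds (by linarith))
    (Eventually.of_forall fun y => besselIntegrand_aestronglyMeasurable v y)
    (besselIntegrand_integrableOn v hz)
    (besselIntegrand_aestronglyMeasurable (v + 1) z).neg
    ?_ (besselIntegrand_integrableOn (v + 1) (half_pos hz)) ?_
  · have h := key.2
    rw [integral_neg] at h
    exact h
  · refine (ae_restrict_mem measurableSet_Ioi).mono fun t ht y hy => ?_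
    have ht : 0 < t := ht
    have hy : z / 2 < y := hy
    rw [norm_neg, Real.norm_of_nonneg (besselIntegrand_pos _ y ht).le]
    gcongr
  · refine (ae_restrict_mem measurableSet_Ioi).mono fun t ht y _ => ?_
    have ht : 0 < t := ht
    have h1 : HasDerivAt (fun y : ℝ => -t - y / t) (-(1 / t)) y := by
      simpa using ((hasDerivAt_id y).div_const t).const_sub (-t)
    have h2 := (h1.exp).const_mul (t ^ (-v - 1))
    refine h2.congr_deriv ?_
    have : t ^ (-(v + 1) - 1) = t ^ (-v - 1) * t⁻¹ := by
      rw [← Real.rpow_neg_one t, ← Real.rpow_add ht]; congr 1; ring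
    rw [this]; ring

/-- Substitution t ↦ z / t, composed of the inversion t ↦ t⁻¹ and a scaling by z⁻¹. -/
theorem besselIntegral_neg (v : ℝ) {z : ℝ} (hz : 0 < z) :
    besselIntegral (-v) z = z ^ v * besselIntegral v z := by
  unfold besselIntegral
  have h1 := integral_comp_rpow_Ioi
    (fun t : ℝ => t ^ (-(-v) - 1) * Real.exp (-t - z / t)) (p := -1) (by norm_num)
  have h2 := integral_comp_mul_left_Ioi
    (fun t : ℝ => (|(-1 : ℝ)| * t ^ ((-1 : ℝ) - 1)) •
      ((t ^ (-1 : ℝ)) ^ (-(-v) - 1) * Real.exp (-t ^ (-1 : ℝ) - z / t ^ (-1 : ℝ)))) 0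
    (inv_pos.2 hz)
  rw [mul_zero, h1, inv_inv, smul_eq_mul] at h2
  rw [← mul_right_inj' hz.ne', ← h2, ← mul_assoc, ← integral_const_mul]
  refine setIntegral_congr_fun measurableSet_Ioi fun t ht => ?_
  have ht : 0 < t := ht
  have e1 : (z⁻¹ * t) ^ (-1 : ℝ) = z / t := by
    rw [Real.rpow_neg_one]; field_simp
  have e2 : (z⁻¹ * t) ^ ((-1 : ℝ) - 1) = z ^ (2 : ℝ) * t ^ (-2 : ℝ) := by
    rw [Real.mul_rpow (by positivity) ht.le, Real.inv_rpow hz.le, ← Real.rpow_neg hz.le]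
    norm_num
  have e3 : (z / t) ^ (-(-v) - 1) = z ^ (v - 1) * t ^ (1 - v) := by
    rw [Real.div_rpow hz.le ht.le, div_eq_mul_inv, ← Real.rpow_neg ht.le]
    congr 2 <;> ring
  have e4 : z / (z / t) = t := by field_simp
  have e5 : -(z / t) - t = -t - z / t := by ring
  have e6 : z ^ (2 : ℝ) * z ^ (v - 1) = z * z ^ v := by
    rw [← Real.rpow_add hz, mul_comm z, ← Real.rpow_add_one hz.ne']; congr 1; ring
  have e7 : t ^ (-2 : ℝ) * t ^ (1 - v) = t ^ (-v - 1) := by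
    rw [← Real.rpow_add ht]; congr 1; ring
  simp only [smul_eq_mul, e1, e2, e3, e4, e5, abs_neg, abs_one, one_mul]
  rw [← e6, ← e7]; ring

theorem besselIntegral_zero {v : ℝ} (hv : 0 < v) : besselIntegral (-v) 0 = Real.Gamma v := by
  rw [Real.Gamma_eq_integral hv]
  refine setIntegral_congr_fun measurableSet_Ioi fun t _ => ?_
  simp [mul_comm]

theorem continuousOn_besselIntegral {v : ℝ} (hv : 0 < v) :
    ContinuousOn (besselIntegral (-v)) (Ici 0) := by
  refine continuousOn_of_dominated (bound := fun t : ℝ => Real.exp (-t) * t ^ (v - 1))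
    (fun z _ => besselIntegrand_aestronglyMeasurable (-v) z) ?_
    (Real.GammaIntegral_convergent hv) ?_
  · intro z hz
    refine (ae_restrict_mem measurableSet_Ioi).mono fun t ht => ?_
    have ht : 0 < t := ht
    have hz : 0 ≤ z := hz
    rw [Real.norm_of_nonneg (besselIntegrand_pos _ z ht).le, mul_comm, neg_neg]
    gcongr
    have : 0 ≤ z / t := by positivity
    linarith
  · exact Eventually.of_forall fun t => by fun_prop

theorem continuous_besselIntegral_order {z : ℝ} (hz : 0 < z) :
    Continuous fun v => besselIntegral v z := by
  refine continuous_iff_continuousAt.2 fun v => ?_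
  refine continuousAt_of_dominated
    -- For |w - v| < 1 the order v - 1 dominates where t ≥ 1 and the order v + 1 where t ≤ 1.
    (bound := fun t : ℝ => t ^ (-(v - 1) - 1) * Real.exp (-t - z / t)
      + t ^ (-(v + 1) - 1) * Real.exp (-t - z / t))
    (Eventually.of_forall fun w => besselIntegrand_aestronglyMeasurable w z) ?_
    ((besselIntegrand_integrableOn _ hz).add (besselIntegrand_integrableOn _ hz)) ?_
  · filter_upwards [Ioo_mem_nhds (sub_one_lt v) (lt_add_one v)] with w hw
    refine (ae_restrict_mem measurableSet_Ioi).mono fun t ht => ?_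
    have ht : 0 < t := ht
    rw [Real.norm_of_nonneg (besselIntegrand_pos _ z ht).le, ← add_mul]
    gcongr
    rcases le_total 1 t with h | h
    · have := Real.rpow_le_rpow_of_exponent_le h (by linarith [hw.1] : -w - 1 ≤ -(v - 1) - 1)
      have h' : 0 < t ^ (-(v + 1) - 1) := by positivity
      linarith
    · have := Real.rpow_le_rpow_of_exponent_ge ht h
        (by linarith [hw.2] : -(v + 1) - 1 ≤ -w - 1)
      have h' : 0 < t ^ (-(v - 1) - 1) := by positivity
      linarith
  · refine (ae_restrict_mem measurableSet_Ioi).mono fun t ht => ?_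
    have ht : 0 < t := ht
    have : ContinuousAt (fun w : ℝ => t ^ (-w - 1)) v :=
      ContinuousAt.rpow (by fun_prop) (by fun_prop) (Or.inl ht.ne')
    exact this.mul continuousAt_const

/-! ### The power series. -/

/-- The entire function `∑ z ^ n / (n! Γ(v + n + 1))`, so that `I_v(x) = (x / 2) ^ v g(x ^ 2 / 4)`. -/
noncomputable def besselSeries (v z : ℝ) : ℝ :=
  ∑' n : ℕ, (Real.Gamma (v + n + 1))⁻¹ * (z ^ n / n.factorial)

theorem exists_abs_inv_Gamma_le (v : ℝ) : ∃ C : ℝ, ∀ n : ℕ, |(Real.Gamma (v + n + 1))⁻¹| ≤ C := by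
  -- From index N on, the argument of Γ is at least 2, where Γ ≥ 1.
  obtain ⟨N, hN⟩ := exists_nat_ge (1 - v)
  refine ⟨∑ n ∈ Finset.range N, |(Real.Gamma (v + n + 1))⁻¹| + 1, fun n => ?_⟩
  rcases lt_or_ge n N with h | h
  · have := Finset.single_le_sum (f := fun n : ℕ => |(Real.Gamma (v + n + 1))⁻¹|)
      (fun i _ => abs_nonneg _) (Finset.mem_range.2 h)
    linarith
  · have h1 : (2 : ℝ) ≤ v + n + 1 := by
      have : (N : ℝ) ≤ n := by exact_mod_cast h
      linarith
    have h2 : 1 ≤ Real.Gamma (v + n + 1) := by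
      refine Real.Gamma_two.symm.le.trans ?_
      exact Real.Gamma_strictMonoOn_Ici.monotoneOn (mem_Ici.2 le_rfl) h1 h1
    have h3 : |(Real.Gamma (v + n + 1))⁻¹| ≤ 1 := by
      rw [abs_inv, abs_of_pos (by linarith)]
      exact inv_le_one_of_one_le₀ h2
    have : 0 ≤ ∑ n ∈ Finset.range N, |(Real.Gamma (v + n + 1))⁻¹| :=
      Finset.sum_nonneg fun i _ => abs_nonneg _
    linarith

theorem summable_mul_pow_div_factorial {a : ℕ → ℝ} {C : ℝ} (ha : ∀ n, |a n| ≤ C) (z : ℝ) :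
    Summable fun n : ℕ => a n * (z ^ n / n.factorial) := by
  refine Summable.of_norm_bounded ((Real.summable_pow_div_factorial |z|).mul_left C) fun n => ?_
  rw [norm_mul, norm_div, norm_pow, Real.norm_natCast]
  exact mul_le_mul_of_nonneg_right (ha n) (by positivity)

theorem hasDerivAt_tsum_mul_pow_div_factorial {a : ℕ → ℝ} {C : ℝ} (ha : ∀ n, |a n| ≤ C) (z : ℝ) :
    HasDerivAt (fun z => ∑' n : ℕ, a n * (z ^ n / n.factorial))
      (∑' n : ℕ, a (n + 1) * (z ^ n / n.factorial)) z := by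
  have hC : 0 ≤ C := (abs_nonneg _).trans (ha 0)
  have hfac : ∀ (n : ℕ) (y : ℝ), ((n + 1 : ℕ) : ℝ) * y ^ n / (n + 1).factorial
      = y ^ n / n.factorial := fun n y => by
    rw [Nat.factorial_succ]; push_cast; field_simp
  have hu : Summable fun n : ℕ => C * (n * (|z| + 1) ^ (n - 1) / n.factorial) := by
    rw [← summable_nat_add_iff 1]
    simp only [add_tsub_cancel_right, hfac]
    exact (Real.summable_pow_div_factorial _).mul_left C
  have hb : ∀ (n : ℕ) (y : ℝ), y ∈ Metric.ball (0 : ℝ) (|z| + 1) →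
      ‖a n * (n * y ^ (n - 1) / n.factorial)‖ ≤ C * (n * (|z| + 1) ^ (n - 1) / n.factorial) := by
    intro n y hy
    have hy' : |y| ≤ |z| + 1 := by
      rw [mem_ball_zero_iff, Real.norm_eq_abs] at hy; exact hy.le
    rw [norm_mul, norm_div, norm_mul, norm_pow, Real.norm_natCast, Real.norm_natCast]
    refine mul_le_mul (ha n) ?_ (by positivity) hC
    rw [Real.norm_eq_abs]
    gcongr
  have hz : z ∈ Metric.ball (0 : ℝ) (|z| + 1) := by
    rw [mem_ball_zero_iff, Real.norm_eq_abs]; linarith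
  have key := hasDerivAt_tsum_of_isPreconnected hu Metric.isOpen_ball
    (convex_ball (0 : ℝ) (|z| + 1)).isPreconnected
    (g := fun n y => a n * (y ^ n / n.factorial))
    (g' := fun n y => a n * (n * y ^ (n - 1) / n.factorial))
    (fun n y _ => ((hasDerivAt_pow n y).div_const _).const_mul _) hb hz
    (summable_mul_pow_div_factorial ha z) hz
  refine key.congr_deriv ?_
  rw [(Summable.of_norm_bounded hu fun n => hb n z hz).tsum_eq_zero_add]
  simp only [add_tsub_cancel_right, hfac]
  simp

theorem hasDerivAt_besselSeries (v z : ℝ) :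
    HasDerivAt (besselSeries v) (besselSeries (v + 1) z) z := by
  obtain ⟨C, hC⟩ := exists_abs_inv_Gamma_le v
  refine (hasDerivAt_tsum_mul_pow_div_factorial hC z).congr_deriv ?_
  refine tsum_congr fun n => ?_
  push_cast
  rw [show v + (n + 1) + 1 = v + 1 + (n : ℝ) + 1 by ring]

theorem besselSeries_zero (v : ℝ) : besselSeries v 0 = (Real.Gamma (v + 1))⁻¹ := by
  unfold besselSeries
  rw [tsum_eq_single 0 fun n hn => by simp [hn]]
  simp

/-- Termwise this is 1 / Γ(v + n) = (v + n) / Γ(v + n + 1); the factor n shifts the index and yields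
the order v + 1. -/
theorem besselSeries_sub_one (v z : ℝ) :
    besselSeries (v - 1) z = v * besselSeries v z + z * besselSeries (v + 1) z := by
  obtain ⟨C, hC⟩ := exists_abs_inv_Gamma_le v
  obtain ⟨D, hD⟩ := exists_abs_inv_Gamma_le (v + 1)
  have h1 := (summable_mul_pow_div_factorial hC z).mul_left v
  have h2 := (summable_mul_pow_div_factorial hD z).mul_left z
  have e2 : ∀ n : ℕ, z * ((Real.Gamma (v + 1 + n + 1))⁻¹ * (z ^ n / n.factorial)) =
      (fun n : ℕ => (Real.Gamma (v + n + 1))⁻¹ * (n * z ^ n / n.factorial)) (n + 1) := fun n => by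
    simp only [Nat.factorial_succ]
    push_cast
    rw [show v + 1 + (n : ℝ) + 1 = v + (n + 1) + 1 by ring]
    field_simp
    ring
  have h3 : Summable fun n : ℕ => (Real.Gamma (v + n + 1))⁻¹ * (n * z ^ n / n.factorial) := by
    rw [← summable_nat_add_iff 1]
    exact h2.congr e2
  unfold besselSeries
  rw [← tsum_mul_left, ← tsum_mul_left, tsum_congr e2]
  have h4 := h3.tsum_eq_zero_add
  simp only [Nat.cast_zero, zero_mul, zero_div, mul_zero, zero_add] at h4
  rw [← h4, ← h1.tsum_add h3]
  refine tsum_congr fun n => ?_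
  rw [show v - 1 + (n : ℝ) + 1 = v + n by ring]
  rcases eq_or_ne (v + (n : ℝ)) 0 with h | h
  -- Here `Real.Gamma 0 = 0` makes the left side 0, in agreement with the factor v + n.
  · have : v = -n := by linarith
    rw [h, Real.Gamma_zero, this]; ring
  · rw [Real.Gamma_add_one h, mul_inv]
    field_simp

theorem hasDerivAt_rpow_mul_besselSeries (v : ℝ) {z : ℝ} (hz : 0 < z) :
    HasDerivAt (fun z => z ^ v * besselSeries v z) (z ^ (v - 1) * besselSeries (v - 1) z) z := by
  have h := (Real.hasDerivAt_rpow_const (p := v) (Or.inl hz.ne')).mul (hasDerivAt_besselSeries v z)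
  refine h.congr_deriv ?_
  rw [besselSeries_sub_one]
  have : z ^ v = z ^ (v - 1) * z := by
    rw [← Real.rpow_add_one hz.ne']; congr 1; ring
  rw [this]; ring

theorem besselI_eq (v : ℝ) {x : ℝ} (hx : 0 < x) :
    besselI v x = (x / 2) ^ v * besselSeries v (x ^ 2 / 4) := by
  unfold besselI besselSeries
  rw [← tsum_mul_left]
  refine tsum_congr fun n => ?_
  have h : (x / 2) ^ (2 * (n : ℝ) + v) = (x ^ 2 / 4) ^ n * (x / 2) ^ v := by
    rw [Real.rpow_add (by positivity), Real.rpow_mul (by positivity), Real.rpow_natCast,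
      Real.rpow_two]
    congr 2; ring
  rw [h, div_eq_mul_inv, mul_inv]; ring

/-! ### Integral equals series for orders in (0, 1). -/

/-- A linear system `F' = -a G`, `G' = -b F` on `(0, ∞)` with nonnegative coefficients having
antiderivatives continuous up to `0` has only the trivial solution with zero initial values. -/
theorem eq_zero_of_coupled_linear_system {F G A B a b : ℝ → ℝ}
    (hF : ContinuousOn F (Ici 0)) (hG : ContinuousOn G (Ici 0))
    (hA : ContinuousOn A (Ici 0)) (hB : ContinuousOn B (Ici 0))
    (ha : ∀ z, 0 < z → 0 ≤ a z) (hb : ∀ z, 0 < z → 0 ≤ b z)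
    (hF' : ∀ z, 0 < z → HasDerivAt F (-a z * G z) z)
    (hG' : ∀ z, 0 < z → HasDerivAt G (-b z * F z) z)
    (hA' : ∀ z, 0 < z → HasDerivAt A (a z) z) (hB' : ∀ z, 0 < z → HasDerivAt B (b z) z)
    (hF0 : F 0 = 0) (hG0 : G 0 = 0) {z : ℝ} (hz : 0 ≤ z) : F z = 0 := by
  -- The derivative of F² + G² is -2 (a + b) F G; the exponential weight completes it to -(a + b) (F
  -- + G)², so this energy decreases from 0.
  have hcont : ContinuousOn (fun z => (F z ^ 2 + G z ^ 2) * Real.exp (-(A z + B z))) (Ici 0) :=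
    ((hF.pow 2).add (hG.pow 2)).mul (Real.continuous_exp.comp_continuousOn (hA.add hB).neg)
  have hder : ∀ z, 0 < z → HasDerivAt (fun z => (F z ^ 2 + G z ^ 2) * Real.exp (-(A z + B z)))
      (-((a z + b z) * (F z + G z) ^ 2 * Real.exp (-(A z + B z)))) z := fun z hz => by
    have h := (((hF' z hz).pow 2).add ((hG' z hz).pow 2)).mul
      (((hA' z hz).add (hB' z hz)).neg).exp
    refine h.congr_deriv ?_
    simp only [Pi.add_apply, Pi.pow_apply, Pi.neg_apply]
    push_cast
    ring
  have hanti : AntitoneOn (fun z => (F z ^ 2 + G z ^ 2) * Real.exp (-(A z + B z))) (Ici 0) := by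
    refine antitoneOn_of_deriv_nonpos (convex_Ici 0) hcont ?_ ?_
    · rw [interior_Ici]
      exact fun z hz => (hder z hz).differentiableAt.differentiableWithinAt
    · rw [interior_Ici]
      intro z hz
      rw [(hder z hz).deriv]
      have := ha z hz
      have := hb z hz
      exact neg_nonpos.2 (by positivity)
  have h := hanti (mem_Ici.2 le_rfl) hz hz
  simp only [hF0, hG0] at h
  have h1 : F z ^ 2 + G z ^ 2 ≤ 0 := by
    refine nonpos_of_mul_nonpos_left ?_ (Real.exp_pos (-(A z + B z)))
    simpa using h
  have h2 : F z ^ 2 = 0 := le_antisymm (by nlinarith [sq_nonneg (G z)]) (sq_nonneg _)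
  exact pow_eq_zero_iff (two_ne_zero) |>.1 h2

theorem sin_mul_pi_ne_zero {v : ℝ} (h0 : 0 < v) (h1 : v < 1) : Real.sin (v * Real.pi) ≠ 0 := by
  refine (Real.sin_pos_of_pos_of_lt_pi (by positivity) ?_).ne'
  nlinarith [Real.pi_pos]

theorem sin_one_sub_mul_pi (v : ℝ) : Real.sin ((1 - v) * Real.pi) = Real.sin (v * Real.pi) := by
  rw [sub_mul, one_mul, Real.sin_pi_sub]

/-- The difference between the integral and its expected series expansion. -/
noncomputable def besselDefect (v z : ℝ) : ℝ :=
  besselIntegral (-v) z -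
    Real.pi / Real.sin (v * Real.pi) * (besselSeries (-v) z - z ^ v * besselSeries v z)

/-- Euler's reflection formula Γ(v) Γ(1 - v) = π / sin (π v) fixes the constant. -/
theorem besselDefect_zero {v : ℝ} (h0 : 0 < v) (h1 : v < 1) : besselDefect v 0 = 0 := by
  have hs := sin_mul_pi_ne_zero h0 h1
  have h := Real.Gamma_mul_Gamma_one_sub v
  have hg : Real.Gamma (1 - v) ≠ 0 := (Real.Gamma_pos_of_pos (by linarith)).ne'
  unfold besselDefect
  rw [besselIntegral_zero h0, besselSeries_zero, Real.zero_rpow h0.ne', mul_comm v, ← h,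
    neg_add_eq_sub]
  field_simp
  ring

theorem continuousOn_besselDefect {v : ℝ} (h0 : 0 < v) :
    ContinuousOn (besselDefect v) (Ici 0) := by
  have h (w : ℝ) : Continuous (besselSeries w) :=
    continuous_iff_continuousAt.2 fun z => (hasDerivAt_besselSeries w z).continuousAt
  have hp : Continuous fun z : ℝ => z ^ v := Real.continuous_rpow_const h0.le
  exact (continuousOn_besselIntegral h0).sub
    (continuous_const.mul ((h _).sub (hp.mul (h _)))).continuousOn

/-- Differentiation raises the order -v to 1 - v, and `besselIntegral_neg` reflects it to -(1 - v);
sin (π v) is unchanged, so the system closes on v and 1 - v. -/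
theorem hasDerivAt_besselDefect (v : ℝ) {z : ℝ} (hz : 0 < z) :
    HasDerivAt (besselDefect v) (-z ^ (v - 1) * besselDefect (1 - v) z) z := by
  have h := (hasDerivAt_besselIntegral (-v) hz).sub
    (((hasDerivAt_besselSeries (-v) z).sub (hasDerivAt_rpow_mul_besselSeries v hz)).const_mul
      (Real.pi / Real.sin (v * Real.pi)))
  refine h.congr_deriv ?_
  have e1 : besselIntegral (-v + 1) z = z ^ (v - 1) * besselIntegral (v - 1) z := by
    rw [← besselIntegral_neg _ hz]; congr 1; ring
  have e2 : z ^ (v - 1) * z ^ (1 - v) = 1 := by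
    rw [← Real.rpow_add hz]; simp
  unfold besselDefect
  rw [e1, sin_one_sub_mul_pi, neg_sub, neg_add_eq_sub]
  linear_combination ((Real.pi / Real.sin (v * Real.pi) * besselSeries (1 - v) z)) * e2

/-- The coefficients z^(v - 1) and z^(-v) are singular at 0, but their antiderivatives z^v / v and
z^(1 - v) / (1 - v) are continuous there. -/
theorem besselDefect_eq_zero {v : ℝ} (h0 : 0 < v) (h1 : v < 1) {z : ℝ} (hz : 0 ≤ z) :
    besselDefect v z = 0 := by
  have h0' : 0 < 1 - v := by linarith
  have hpow {w : ℝ} (hw : 0 < w) : ContinuousOn (fun z : ℝ => z ^ w / w) (Ici 0) :=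
    ((Real.continuous_rpow_const hw.le).div_const w).continuousOn
  have hpow' {w : ℝ} (hw : 0 < w) (z : ℝ) (hz : 0 < z) :
      HasDerivAt (fun z : ℝ => z ^ w / w) (z ^ (w - 1)) z := by
    refine ((Real.hasDerivAt_rpow_const (p := w) (Or.inl hz.ne')).div_const w).congr_deriv ?_
    field_simp
  refine eq_zero_of_coupled_linear_system (continuousOn_besselDefect h0)
    (continuousOn_besselDefect h0') (hpow h0) (hpow h0')
    (fun z hz => (Real.rpow_pos_of_pos hz _).le) (fun z hz => (Real.rpow_pos_of_pos hz _).le)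
    (fun z hz => hasDerivAt_besselDefect v hz) (fun z hz => ?_) (hpow' h0) (hpow' h0')
    (besselDefect_zero h0 h1) (besselDefect_zero h0' (by linarith)) hz
  have h := hasDerivAt_besselDefect (1 - v) hz
  rwa [sub_sub_cancel] at h

/-! ### Extension to all orders, and the formula for K. -/

/-- The expansion of the integral at the order `v` in terms of the two series. -/
def HasBesselExpansion (v : ℝ) : Prop :=
  ∀ z, 0 < z → besselIntegral v z =
    Real.pi / Real.sin (v * Real.pi) * (z ^ (-v) * besselSeries (-v) z - besselSeries v z)

theorem HasBesselExpansion.neg {v : ℝ} (h : HasBesselExpansion v) : HasBesselExpansion (-v) := by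
  intro z hz
  have e : z ^ v * z ^ (-v) = 1 := by rw [← Real.rpow_add hz]; simp
  rw [besselIntegral_neg v hz, h z hz, neg_mul, Real.sin_neg, neg_neg, div_neg]
  linear_combination (Real.pi / Real.sin (v * Real.pi) * besselSeries (-v) z) * e

/-- Differentiate the expansion in z; the minus sign is absorbed by sin (π v + π) = -sin (π v). -/
theorem HasBesselExpansion.add_one {v : ℝ} (h : HasBesselExpansion v) :
    HasBesselExpansion (v + 1) := by
  intro z hz
  have h1 := hasDerivAt_besselIntegral v hz
  have h2 := ((hasDerivAt_rpow_mul_besselSeries (-v) hz).sub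
    (hasDerivAt_besselSeries v z)).const_mul (Real.pi / Real.sin (v * Real.pi))
  have h3 : besselIntegral v =ᶠ[𝓝 z] fun z => Real.pi / Real.sin (v * Real.pi) *
      (z ^ (-v) * besselSeries (-v) z - besselSeries v z) := by
    filter_upwards [Ioi_mem_nhds hz] with y hy using h y hy
  have h4 := (h1.congr_of_eventuallyEq h3.symm).unique h2
  rw [add_mul, one_mul, Real.sin_add_pi, div_neg, neg_add']
  linear_combination -h4

theorem hasBesselExpansion_of_mem_Ioo {v : ℝ} (h0 : 0 < v) (h1 : v < 1) :
    HasBesselExpansion v := by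
  rw [← neg_neg v]
  refine HasBesselExpansion.neg fun z hz => ?_
  have h := besselDefect_eq_zero h0 h1 hz.le
  unfold besselDefect at h
  rw [neg_mul, Real.sin_neg, neg_neg, div_neg]
  linear_combination h

theorem hasBesselExpansion_of_pos {v : ℝ} (hv : v ∉ range ((↑) : ℤ → ℝ)) (h0 : 0 < v) :
    HasBesselExpansion v := by
  have h1 : 0 < Int.fract v := by
    refine lt_of_le_of_ne (Int.fract_nonneg v) fun h => hv ?_
    exact ⟨⌊v⌋, by rw [← Int.self_sub_fract, ← h, sub_zero]⟩
  have h2 (n : ℕ) : HasBesselExpansion (Int.fract v + n) := by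
    induction n with
    | zero => simpa using hasBesselExpansion_of_mem_Ioo h1 (Int.fract_lt_one v)
    | succ n ih => simpa [add_assoc] using ih.add_one
  have h3 := h2 ⌊v⌋₊
  rwa [natCast_floor_eq_intCast_floor h0.le, Int.fract_add_floor] at h3

theorem hasBesselExpansion {v : ℝ} (hv : v ∉ range ((↑) : ℤ → ℝ)) : HasBesselExpansion v := by
  rcases lt_trichotomy v 0 with h | h | h
  · rw [← neg_neg v]
    refine (hasBesselExpansion_of_pos ?_ (neg_pos.2 h)).neg
    rintro ⟨n, hn⟩
    exact hv ⟨-n, by push_cast; linarith⟩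
  · exact absurd ⟨0, by simp [h]⟩ hv
  · exact hasBesselExpansion_of_pos hv h

theorem besselKQuotient_eq {v : ℝ} (hv : v ∉ range ((↑) : ℤ → ℝ)) {x : ℝ} (hx : 0 < x) :
    besselKQuotient v x = (x / 2) ^ v / 2 * besselIntegral v (x ^ 2 / 4) := by
  unfold besselKQuotient
  have e : (x ^ 2 / 4) ^ (-v) * (x / 2) ^ v = (x / 2) ^ (-v) := by
    rw [show x ^ 2 / 4 = (x / 2) ^ (2 : ℝ) by rw [Real.rpow_two]; ring,
      ← Real.rpow_mul (by positivity), ← Real.rpow_add (by positivity)]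
    congr 1; ring
  rw [besselI_eq _ hx, besselI_eq _ hx, hasBesselExpansion hv _ (by positivity), ← e]
  ring

theorem eventually_notMem_range_intCast (v : ℝ) :
    ∀ᶠ w in 𝓝[≠] v, w ∉ range ((↑) : ℤ → ℝ) := by
  have h1 : IsClosed (((↑) : ℤ → ℝ) '' {n | (n : ℝ) ≠ v}) :=
    Int.isClosedEmbedding_coe_real.isClosedMap _ (isClosed_discrete _)
  have h2 : (((↑) : ℤ → ℝ) '' {n | (n : ℝ) ≠ v})ᶜ ∈ 𝓝 v :=
    h1.isOpen_compl.mem_nhds fun ⟨n, hn, h⟩ => hn h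
  filter_upwards [nhdsWithin_le_nhds h2, self_mem_nhdsWithin] with w hw hne
  rintro ⟨n, rfl⟩
  exact hw ⟨n, hne, rfl⟩

/-- At an integer order the limit is taken along nearby non-integer orders, and the right side is
continuous in the order. -/
theorem besselK_eq (v : ℝ) {x : ℝ} (hx : 0 < x) :
    besselK v x = (x / 2) ^ v / 2 * besselIntegral v (x ^ 2 / 4) := by
  unfold besselK
  split_ifs with h
  · have hc : Continuous fun w : ℝ => (x / 2) ^ w / 2 * besselIntegral w (x ^ 2 / 4) :=
      ((Real.continuous_const_rpow (by positivity)).div_const 2).mul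
        (continuous_besselIntegral_order (by positivity))
    refine Tendsto.limUnder_eq ((hc.tendsto v).mono_left nhdsWithin_le_nhds |>.congr' ?_)
    filter_upwards [eventually_notMem_range_intCast v] with w hw
    exact (besselKQuotient_eq hw hx).symm
  · exact besselKQuotient_eq h hx

theorem besselK_pos (v : ℝ) {x : ℝ} (hx : 0 < x) : 0 < besselK v x := by
  rw [besselK_eq v hx]
  have := besselIntegral_pos v (z := x ^ 2 / 4) (by positivity)
  positivity

theorem besselK_neg (v : ℝ) {x : ℝ} (hx : 0 < x) : besselK (-v) x = besselK v x := by
  rw [besselK_eq _ hx, besselK_eq _ hx, besselIntegral_neg v (by positivity)]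
  have e : (x / 2) ^ (-v) * (x ^ 2 / 4) ^ v = (x / 2) ^ v := by
    rw [show x ^ 2 / 4 = (x / 2) ^ (2 : ℝ) by rw [Real.rpow_two]; ring,
      ← Real.rpow_mul (by positivity), ← Real.rpow_add (by positivity)]
    congr 1; ring
  rw [← e]; ring

/-! ### Derivatives, decay and Bessel's equation. -/

theorem hasDerivAt_besselK (v : ℝ) {x : ℝ} (hx : 0 < x) :
    HasDerivAt (besselK v) (v / x * besselK v x - besselK (v + 1) x) x := by
  have h1 : HasDerivAt (fun y : ℝ => y / 2) (1 / 2) x := (hasDerivAt_id x).div_const 2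
  have h2 := (h1.rpow_const (p := v) (Or.inl (by positivity))).div_const 2
  have h3 : HasDerivAt (fun y : ℝ => y ^ 2 / 4) (x / 2) x :=
    ((hasDerivAt_pow 2 x).div_const 4).congr_deriv (by norm_num; ring)
  have h4 := (hasDerivAt_besselIntegral v (z := x ^ 2 / 4) (by positivity)).comp x h3
  have h5 : besselK v =ᶠ[𝓝 x] fun y => (y / 2) ^ v / 2 * besselIntegral v (y ^ 2 / 4) := by
    filter_upwards [Ioi_mem_nhds hx] with y hy using besselK_eq v hy
  refine ((h2.mul h4).congr_of_eventuallyEq h5).congr_deriv ?_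
  rw [besselK_eq v hx, besselK_eq (v + 1) hx, Real.rpow_add_one (by positivity),
    Real.rpow_sub_one (by positivity)]
  simp only [Function.comp]
  field_simp
  ring

theorem hasDerivAt_besselK' (v : ℝ) {x : ℝ} (hx : 0 < x) :
    HasDerivAt (besselK v) (-(v / x) * besselK v x - besselK (v - 1) x) x := by
  have h := hasDerivAt_besselK (-v) hx
  have h5 : besselK v =ᶠ[𝓝 x] besselK (-v) := by
    filter_upwards [Ioi_mem_nhds hx] with y hy using (besselK_neg v hy).symm
  refine (h.congr_of_eventuallyEq h5).congr_deriv ?_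
  rw [besselK_neg v hx, show -v + 1 = -(v - 1) by ring, besselK_neg _ hx]
  ring

theorem tendsto_mul_besselK_atTop (v : ℝ) : Tendsto (fun x => x * besselK v x) atTop (𝓝 0) := by
  -- This m makes m - v positive and the exponent v + 1 - 2m of x / 2 negative.
  obtain ⟨m, hm⟩ := exists_nat_gt (|v| + 2)
  have hv := abs_le.1 (le_refl |v|)
  have hlim : Tendsto (fun x : ℝ => ((m.factorial : ℝ) * Real.Gamma (m - v)) *
      (x / 2) ^ (-((m : ℝ) * 2 - v - 1))) atTop (𝓝 0) := by
    have := (tendsto_rpow_neg_atTop (y := (m : ℝ) * 2 - v - 1) (by linarith)).comp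
      (tendsto_id.atTop_div_const (two_pos (α := ℝ)))
    simpa using this.const_mul ((m.factorial : ℝ) * Real.Gamma (m - v))
  refine tendsto_of_tendsto_of_tendsto_of_le_of_le' tendsto_const_nhds hlim ?_ ?_
  · filter_upwards [eventually_gt_atTop 0] with x hx
    exact (mul_pos hx (besselK_pos v hx)).le
  · filter_upwards [eventually_gt_atTop 0] with x hx
    have h2 : 0 < x / 2 := by positivity
    have h := besselIntegral_le v m (by linarith) (z := x ^ 2 / 4) (by positivity)
    have e : (x / 2) ^ (-((m : ℝ) * 2 - v - 1)) * (x ^ 2 / 4) ^ m = x / 2 * (x / 2) ^ v := by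
      rw [show x ^ 2 / 4 = (x / 2) ^ 2 by ring, ← pow_mul, ← Real.rpow_natCast,
        ← Real.rpow_add h2, mul_comm (x / 2), ← Real.rpow_add_one h2.ne']
      congr 1
      push_cast
      ring
    rw [besselK_eq v hx]
    calc x * ((x / 2) ^ v / 2 * besselIntegral v (x ^ 2 / 4))
        ≤ x * ((x / 2) ^ v / 2 * (m.factorial / (x ^ 2 / 4) ^ m * Real.Gamma (m - v))) := by
          gcongr
      _ = m.factorial * Real.Gamma (m - v) / (x ^ 2 / 4) ^ m * (x / 2 * (x / 2) ^ v) := by ring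
      _ = _ := by rw [← e]; field_simp

theorem neg_of_deriv_pos_of_tendsto_zero {f f' : ℝ → ℝ}
    (hf : ∀ x, 0 < x → HasDerivAt f (f' x) x) (hf' : ∀ x, 0 < x → 0 < f' x)
    (hlim : Tendsto f atTop (𝓝 0)) {x : ℝ} (hx : 0 < x) : f x < 0 := by
  have hmono : StrictMonoOn f (Ioi 0) := by
    refine strictMonoOn_of_deriv_pos (convex_Ioi 0)
      (fun y hy => (hf y hy).continuousAt.continuousWithinAt) fun y hy => ?_
    rw [interior_Ioi] at hy
    rw [(hf y hy).deriv]
    exact hf' y hy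
  -- The intermediate point x + 1 keeps the inequality strict after passing to the limit.
  have h1 : f x < f (x + 1) := hmono hx (mem_Ioi.2 (by linarith)) (by linarith)
  refine h1.trans_le (ge_of_tendsto hlim ?_)
  filter_upwards [eventually_ge_atTop (x + 1)] with y hy
  exact hmono.monotoneOn (mem_Ioi.2 (by linarith)) (mem_Ioi.2 (by linarith)) hy

/-- `x K_v'(x)`, expressed without derivatives. -/
noncomputable def besselKTheta (v x : ℝ) : ℝ := v * besselK v x - x * besselK (v + 1) x

theorem mul_deriv_besselK (v : ℝ) {x : ℝ} (hx : 0 < x) :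
    x * deriv (besselK v) x = besselKTheta v x := by
  rw [(hasDerivAt_besselK v hx).deriv, besselKTheta]; field_simp

theorem hasDerivAt_besselK_theta (v : ℝ) {x : ℝ} (hx : 0 < x) :
    HasDerivAt (besselK v) (besselKTheta v x / x) x :=
  (hasDerivAt_besselK v hx).congr_deriv (by rw [besselKTheta]; field_simp)

/-- Bessel's equation, obtained by raising the order from v and lowering it from v + 1. -/
theorem hasDerivAt_besselKTheta (v : ℝ) {x : ℝ} (hx : 0 < x) :
    HasDerivAt (besselKTheta v) ((x ^ 2 + v ^ 2) / x * besselK v x) x := by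
  have h := ((hasDerivAt_besselK v hx).const_mul v).sub
    ((hasDerivAt_id x).mul (hasDerivAt_besselK' (v + 1) hx))
  refine h.congr_deriv ?_
  simp only [id, add_sub_cancel_right]
  field_simp
  ring

/-- The raising formula has both terms of one sign for v ≤ 0, the lowering formula for v ≥ 0. -/
theorem besselKTheta_neg (v : ℝ) {x : ℝ} (hx : 0 < x) : besselKTheta v x < 0 := by
  have h1 := besselK_pos v hx
  rcases le_total v 0 with h | h
  · have := mul_pos hx (besselK_pos (v + 1) hx)
    unfold besselKTheta
    nlinarith
  · have h2 := (hasDerivAt_besselK_theta v hx).unique (hasDerivAt_besselK' v hx)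
    have h3 := mul_pos hx (besselK_pos (v - 1) hx)
    have h4 : besselKTheta v x = -(v * besselK v x) - x * besselK (v - 1) x := by
      field_simp at h2
      linarith
    nlinarith

theorem tendsto_besselK_atTop (v : ℝ) : Tendsto (besselK v) atTop (𝓝 0) := by
  have h := tendsto_inv_atTop_zero.mul (tendsto_mul_besselK_atTop v)
  rw [mul_zero] at h
  refine h.congr' ?_
  filter_upwards [eventually_gt_atTop 0] with x hx
  field_simp

theorem tendsto_besselKTheta_atTop (v : ℝ) : Tendsto (besselKTheta v) atTop (𝓝 0) := by
  have h := ((tendsto_besselK_atTop v).const_mul v).sub (tendsto_mul_besselK_atTop (v + 1))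
  rw [mul_zero, sub_zero] at h
  exact h

/-! ### Signs of the linear and quadratic expressions. -/

/-- The quantity `x K_v' + (x + 1/2) K_v`, whose sign is that of `1/4 - v ^ 2`. -/
noncomputable def besselKLinear (v x : ℝ) : ℝ := besselKTheta v x + (x + 1 / 2) * besselK v x

/-- Bessel's equation gives x L' = (x + 1/2) L + (v² - 1/4) K_v, whose integrating factor is e^{-x}
x^{-1/2}. -/
theorem hasDerivAt_exp_mul_besselKLinear (v : ℝ) {x : ℝ} (hx : 0 < x) :
    HasDerivAt (fun x => Real.exp (-x) * x ^ (-(1 / 2) : ℝ) * besselKLinear v x)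
      ((v ^ 2 - 1 / 4) * (Real.exp (-x) * x ^ (-(1 / 2) : ℝ) / x * besselK v x)) x := by
  have h1 : HasDerivAt (besselKLinear v) ((x ^ 2 + v ^ 2) / x * besselK v x +
      (1 * besselK v x + (x + 1 / 2) * (besselKTheta v x / x))) x :=
    (hasDerivAt_besselKTheta v hx).add
      (((hasDerivAt_id x).add_const (1 / 2)).mul (hasDerivAt_besselK_theta v hx))
  have h2 := ((hasDerivAt_neg x).exp.mul
    (Real.hasDerivAt_rpow_const (p := (-(1 / 2) : ℝ)) (Or.inl hx.ne'))).mul h1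
  refine h2.congr_deriv ?_
  rw [Real.rpow_sub_one hx.ne', besselKLinear]
  simp only [Pi.mul_apply]
  field_simp
  ring

theorem tendsto_exp_mul_besselKLinear (v : ℝ) :
    Tendsto (fun x => Real.exp (-x) * x ^ (-(1 / 2) : ℝ) * besselKLinear v x) atTop (𝓝 0) := by
  have h1 : Tendsto (besselKLinear v) atTop (𝓝 0) := by
    have h := (tendsto_besselKTheta_atTop v).add
      ((tendsto_mul_besselK_atTop v).add ((tendsto_besselK_atTop v).const_mul (1 / 2)))
    simp only [mul_zero, add_zero] at h
    refine h.congr fun x => ?_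
    unfold besselKLinear; ring
  have h2 := ((Real.tendsto_exp_atBot.comp tendsto_neg_atTop_atBot).mul
    (tendsto_rpow_neg_atTop (y := 1 / 2) (by norm_num))).mul h1
  simpa using h2

theorem besselKLinear_neg {v : ℝ} (hv : 1 / 4 < v ^ 2) {x : ℝ} (hx : 0 < x) :
    besselKLinear v x < 0 := by
  have h := neg_of_deriv_pos_of_tendsto_zero
    (fun x hx => hasDerivAt_exp_mul_besselKLinear v hx) (fun x hx => ?_)
    (tendsto_exp_mul_besselKLinear v) hx
  · exact neg_of_mul_neg_right h (by positivity)
  · have := besselK_pos v hx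
    have : 0 < v ^ 2 - 1 / 4 := by linarith
    positivity

theorem besselKLinear_pos {v : ℝ} (hv : v ^ 2 < 1 / 4) {x : ℝ} (hx : 0 < x) :
    0 < besselKLinear v x := by
  have h := neg_of_deriv_pos_of_tendsto_zero
    (fun x hx => (hasDerivAt_exp_mul_besselKLinear v hx).neg) (fun x hx => ?_)
    (neg_zero (G := ℝ) ▸ (tendsto_exp_mul_besselKLinear v).neg) hx
  · exact pos_of_mul_pos_right (neg_lt_zero.1 h) (by positivity)
  · have := besselK_pos v hx
    have : 0 < 1 / 4 - v ^ 2 := by linarith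
    have : 0 < (1 / 4 - v ^ 2) * (Real.exp (-x) * x ^ (-(1 / 2) : ℝ) / x * besselK v x) := by
      positivity
    linarith

/-- The quantity `(x K_v') ^ 2 - (x ^ 2 + x + v ^ 2) K_v ^ 2`. -/
noncomputable def besselKQuadratic (v x : ℝ) : ℝ :=
  besselKTheta v x ^ 2 - (x ^ 2 + x + v ^ 2) * besselK v x ^ 2

/-- The terms in (x² + v²) θ K_v cancel, leaving a multiple of L. -/
theorem hasDerivAt_besselKQuadratic (v : ℝ) {x : ℝ} (hx : 0 < x) :
    HasDerivAt (besselKQuadratic v) (-(2 * besselK v x * besselKLinear v x)) x := by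
  have h1 : HasDerivAt (fun x : ℝ => x ^ 2 + x + v ^ 2) (2 * x + 1) x := by
    simpa using ((hasDerivAt_pow 2 x).add (hasDerivAt_id x)).add_const (v ^ 2)
  have h := ((hasDerivAt_besselKTheta v hx).pow 2).sub
    (h1.mul ((hasDerivAt_besselK_theta v hx).pow 2))
  refine h.congr_deriv ?_
  simp only [Pi.pow_apply, besselKLinear]
  push_cast
  field_simp
  ring

theorem tendsto_besselKQuadratic (v : ℝ) : Tendsto (besselKQuadratic v) atTop (𝓝 0) := by
  have hK := tendsto_besselK_atTop v
  have hxK := tendsto_mul_besselK_atTop v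
  have h := ((tendsto_besselKTheta_atTop v).pow 2).sub
    (((hxK.pow 2).add (hxK.mul hK)).add ((hK.pow 2).const_mul (v ^ 2)))
  norm_num at h
  refine h.congr fun x => ?_
  unfold besselKQuadratic; ring

theorem besselKQuadratic_neg {v : ℝ} (hv : 1 / 4 < v ^ 2) {x : ℝ} (hx : 0 < x) :
    besselKQuadratic v x < 0 :=
  neg_of_deriv_pos_of_tendsto_zero (fun x hx => hasDerivAt_besselKQuadratic v hx)
    (fun x hx => by nlinarith [mul_pos (besselK_pos v hx) (neg_pos.2 (besselKLinear_neg hv hx))])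
    (tendsto_besselKQuadratic v) hx

theorem besselKQuadratic_pos {v : ℝ} (hv : v ^ 2 < 1 / 4) {x : ℝ} (hx : 0 < x) :
    0 < besselKQuadratic v x :=
  neg_lt_zero.1 <| neg_of_deriv_pos_of_tendsto_zero
    (fun x hx => (hasDerivAt_besselKQuadratic v hx).neg)
    (fun x hx => by nlinarith [mul_pos (besselK_pos v hx) (besselKLinear_pos hv hx)])
    (neg_zero (G := ℝ) ▸ (tendsto_besselKQuadratic v).neg) hx

theorem sqrt_sq_add_self_add_half_sq {x : ℝ} (hx : 0 < x) :
    Real.sqrt (x ^ 2 + x + (1 / 2) ^ 2) = x + 1 / 2 := by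
  rw [show x ^ 2 + x + (1 / 2) ^ 2 = (x + 1 / 2) ^ 2 by ring, Real.sqrt_sq (by linarith)]

theorem mainTheorem9 (v : ℝ) (hv : |v| ≠ 1 / 2) (x : ℝ) (hx : 0 < x) :
    -Real.sqrt (x ^ 2 + x + (max |v| (1 / 2)) ^ 2)
        < x * deriv (fun y : ℝ => besselK v y) x / besselK v x ∧
      x * deriv (fun y : ℝ => besselK v y) x / besselK v x
        < -Real.sqrt (x ^ 2 + x + (min |v| (1 / 2)) ^ 2) := by
  have hK := besselK_pos v hx
  have hsq : (besselKTheta v x / besselK v x) ^ 2 - (x ^ 2 + x + v ^ 2)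
      = besselKQuadratic v x / besselK v x ^ 2 := by
    unfold besselKQuadratic; field_simp
  have hlin : besselKTheta v x / besselK v x + (x + 1 / 2)
      = besselKLinear v x / besselK v x := by
    unfold besselKLinear; field_simp
  rw [mul_deriv_besselK v hx]
  rcases lt_or_gt_of_ne hv with h | h
  · have hv2 : v ^ 2 < 1 / 4 := by nlinarith [sq_abs v, abs_nonneg v]
    rw [max_eq_right h.le, min_eq_left h.le, sq_abs, sqrt_sq_add_self_add_half_sq hx]
    constructor
    · have := div_pos (besselKLinear_pos hv2 hx) hK
      linarith
    · have h1 := div_pos (besselKQuadratic_pos hv2 hx) (pow_pos hK 2)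
      have h2 := div_neg_of_neg_of_pos (besselKTheta_neg v hx) hK
      -- Squares can be compared because θ / K_v is negative.
      rw [lt_neg, Real.sqrt_lt' (neg_pos.2 h2), neg_sq]
      linarith
  · have hv2 : 1 / 4 < v ^ 2 := by nlinarith [sq_abs v, abs_nonneg v]
    rw [max_eq_left h.le, min_eq_right h.le, sq_abs, sqrt_sq_add_self_add_half_sq hx]
    constructor
    · have h1 := div_neg_of_neg_of_pos (besselKQuadratic_neg hv2 hx) (pow_pos hK 2)
      refine neg_lt.2 (Real.lt_sqrt_of_sq_lt ?_)
      rw [neg_sq]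
      linarith
    · have := div_neg_of_neg_of_pos (besselKLinear_neg hv2 hx) hK
      linarith
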